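/- Let $X$ and $Y$ be locally compact Hausdorff spaces, and let $C_c(X)$ be the space of continuous real-valued functions on $X$ with compact support. For $f\in C_c(X)$ let $B(f)=\{\phi\circ f:\ \phi\in C(\mathbb R),\ \phi(0)=0\}$ be the closed subalgebra of $C_c(X)$ generated by $f$. A *quasi-integral* on $C_c(X)$ is a map $\rho:C_c(X)\to\mathbb R$ such that $\rho(af)=a\rho(f)$ for all $a\in\mathbb R$ and $f\in C_c(X)$, $\rho(g+h)=\rho(g)+\rho(h)$ whenever $g,h\in B(f)$ for some $f\in C_c(X)$, and $\rho(f)\ge 0$ whenever $f\ge 0$. A *topological measure* on $X$ is a function $\mu$ from the open and the closed subsets of $X$ to $[0,\infty]$ such that (i) $\mu(A\sqcup B)=\mu(A)+\mu(B)$ whenever $A$, $B$ and the disjoint union $A\sqcup B$ are each compact or open; (ii) $\mu(U)=\sup\{\mu(K): K\subseteq U,\ K\text{ compact}\}$ for $U$ open; (iii) $\mu(F)=\inf\{\mu(U): U\supseteq F,\ U\text{ open}\}$ for $F$ closed. It is *compact-finite* if $\mu(K)<\infty$ for every compact $K$. To a quasi-integral $\rho$ on $C_c(X)$ there corresponds the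 compact-finite topological measure $\mu$ given by $\mu(U)=\sup\{\rho(f): f\in C_c(X),\ 0\le f\le 1,\ \operatorname{supp} f\subseteq U\}$ for $U$ open and $\mu(F)=\inf\{\mu(U): U\supseteq F,\ U\text{ open}\}$ for $F$ closed. We say that $\mu$ *is a measure* if it is the restriction of a Borel measure to the open and the closed sets. The same definitions apply to $Y$. Let $\rho$ be a nonzero quasi-integral on $C_c(X)$ and $\eta$ a nonzero quasi-integral on $C_c(Y)$, with corresponding compact-finite topological measures $\mu$ on $X$ and $\nu$ on $Y$. For $f\in C_c(X\times Y)$ the functions $T_\rho(f)(y)=\rho(f(\cdot,y))$ and $S_\eta(f)(x)=\eta(f(x,\cdot))$ belong to $C_c(Y)$ and $C_c(X)$ respectively; define the repeated quasi-integrals, as functionals on $C_c(X\times Y)$, by $$(\eta\times\rho)(f)=\eta(T_\rho(f)),\qquad (\rho\times\eta)(f)=\rho(S_\eta(f)).$$ **Theorem.** $\eta\times\rho=\rho\times\eta$ on $C_c(X\times Y)$ if and only if $\mu$ and $\nu$ are both measures, or at least one of $\mu,\nu$ is a positive (finite) scalar multiple of a point mass. -/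

import Mathlib

open scoped CompactlySupported ENNReal NNReal

/-- The closed subalgebra `B(f)` of `C_c(X)` generated by `f`: all compositions `φ ∘ f` with
`φ` continuous and `φ 0 = 0`. By Tietze extension it does not matter whether `φ` is continuous
on the range of `f` only or on the whole line. -/
def singlyGenerated {X : Type*} [TopologicalSpace X] (f : C_c(X, ℝ)) : Set C_c(X, ℝ) :=
  {g | ∃ φ : C(ℝ, ℝ), φ 0 = 0 ∧ ∀ x, g x = φ (f x)}

/-- A quasi-integral (quasi-linear functional) on `C_c(X)`. -/
structure QuasiIntegral (X : Type*) [TopologicalSpace X] where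
  toFun : C_c(X, ℝ) → ℝ
  map_smul' : ∀ (a : ℝ) (f : C_c(X, ℝ)), toFun (a • f) = a * toFun f
  map_add' : ∀ f : C_c(X, ℝ), ∀ g ∈ singlyGenerated f, ∀ h ∈ singlyGenerated f,
    toFun (g + h) = toFun g + toFun h
  nonneg' : ∀ f : C_c(X, ℝ), (∀ x, 0 ≤ f x) → 0 ≤ toFun f

/-- A topological measure on a locally compact space. Only the values on open sets and on closed
sets are meaningful; no condition is imposed on any other set. -/
structure TopologicalMeasure (X : Type*) [TopologicalSpace X] where
  toFun : Set X → ℝ≥0∞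
  union' : ∀ A B : Set X, Disjoint A B → (IsCompact A ∨ IsOpen A) → (IsCompact B ∨ IsOpen B) →
    (IsCompact (A ∪ B) ∨ IsOpen (A ∪ B)) → toFun (A ∪ B) = toFun A + toFun B
  inner' : ∀ U : Set X, IsOpen U → toFun U = ⨆ (K : Set X) (_ : IsCompact K ∧ K ⊆ U), toFun K
  outer' : ∀ F : Set X, IsClosed F → toFun F = ⨅ (U : Set X) (_ : IsOpen U ∧ F ⊆ U), toFun U

namespace TopologicalMeasure

variable {X : Type*} [TopologicalSpace X]

instance : CoeFun (TopologicalMeasure X) (fun _ => Set X → ℝ≥0∞) := ⟨toFun⟩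

/-- `μ` is finite on compact sets. -/
def CompactFinite (μ : TopologicalMeasure X) : Prop := ∀ K : Set X, IsCompact K → μ K < ∞

/-- `μ` is a measure: it is the restriction of a Borel measure to the open and the closed sets. -/
def IsMeasure (μ : TopologicalMeasure X) : Prop :=
  ∃ m : @MeasureTheory.Measure X (borel X), ∀ A : Set X, IsOpen A ∨ IsClosed A → m A = μ A

/-- `μ` is a positive (finite) scalar multiple of a point mass. -/
def IsPosMulPointMass (μ : TopologicalMeasure X) : Prop :=
  ∃ c : ℝ≥0, 0 < c ∧ ∃ x₀ : X, ∀ A : Set X, IsOpen A ∨ IsClosed A →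
    μ A = A.indicator (fun _ => (c : ℝ≥0∞)) x₀

end TopologicalMeasure

namespace QuasiIntegral

section basic

variable {X : Type*} [TopologicalSpace X]

instance : CoeFun (QuasiIntegral X) (fun _ => C_c(X, ℝ) → ℝ) := ⟨toFun⟩

theorem map_smul (ρ : QuasiIntegral X) (a : ℝ) (f : C_c(X, ℝ)) : ρ (a • f) = a * ρ f :=
  ρ.map_smul' a f

theorem nonneg (ρ : QuasiIntegral X) {f : C_c(X, ℝ)} (hf : ∀ x, 0 ≤ f x) : 0 ≤ ρ f :=
  ρ.nonneg' f hf

theorem map_zero (ρ : QuasiIntegral X) : ρ 0 = 0 := by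
  simpa using ρ.map_smul 0 0

theorem map_add (ρ : QuasiIntegral X) {f g h : C_c(X, ℝ)} (hg : g ∈ singlyGenerated f)
    (hh : h ∈ singlyGenerated f) : ρ (g + h) = ρ g + ρ h := ρ.map_add' f g hg h hh

theorem map_sub (ρ : QuasiIntegral X) {f g h : C_c(X, ℝ)} (hg : g ∈ singlyGenerated f)
    (hh : h ∈ singlyGenerated f) : ρ (g - h) = ρ g - ρ h := by
  have h1 : (-1 : ℝ) • h ∈ singlyGenerated f := by
    obtain ⟨φ, h0, hφ⟩ := hh
    exact ⟨-φ, by simp [h0], fun x => by simp [hφ x]⟩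
  have h2 := ρ.map_add hg h1
  rw [ρ.map_smul] at h2
  have h3 : g - h = g + (-1 : ℝ) • h := by ext x; simp [sub_eq_add_neg]
  rw [h3, h2]; ring

/-- If `v` equals its upper bound `c` wherever `u` does not vanish, then `u` and `v` lie in
the subalgebra generated by `u + v`. -/
theorem stack_mem {u v : C_c(X, ℝ)} {c : ℝ} (hc : 0 ≤ c) (hu : ∀ x, 0 ≤ u x)
    (hv : ∀ x, v x ≤ c) (h : ∀ x, u x ≠ 0 → v x = c) :
    u ∈ singlyGenerated (u + v) ∧ v ∈ singlyGenerated (u + v) := by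
  constructor
  · refine ⟨⟨fun t => max (t - c) 0, by fun_prop⟩, by simp [hc], fun x => ?_⟩
    by_cases hx : u x = 0
    · simp [hx, hv x]
    · simp [h x hx, hu x]
  · refine ⟨⟨fun t => min t c, by fun_prop⟩, by simp [hc], fun x => ?_⟩
    by_cases hx : u x = 0
    · simp [hx, hv x]
    · simp [h x hx, hu x]

theorem map_le_of_stack (ρ : QuasiIntegral X) {u v : C_c(X, ℝ)} {c : ℝ} (hc : 0 ≤ c)
    (hu : ∀ x, 0 ≤ u x) (hv : ∀ x, v x ≤ c) (h : ∀ x, u x ≠ 0 → v x = c)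
    (huv : ∀ x, u x ≤ v x) : ρ u ≤ ρ v := by
  obtain ⟨h1, h2⟩ := stack_mem hc hu hv h
  have h3 := ρ.map_sub h2 h1
  have h4 : 0 ≤ ρ (v - u) := ρ.nonneg fun x => by simpa using huv x
  linarith

theorem map_add_of_stack (ρ : QuasiIntegral X) {u v : C_c(X, ℝ)} {c : ℝ} (hc : 0 ≤ c)
    (hu : ∀ x, 0 ≤ u x) (hv : ∀ x, v x ≤ c) (h : ∀ x, u x ≠ 0 → v x = c) :
    ρ (u + v) = ρ u + ρ v :=
  let ⟨h1, h2⟩ := stack_mem hc hu hv h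
  ρ.map_add h1 h2

theorem map_eq_pos_sub_neg (ρ : QuasiIntegral X) (f : C_c(X, ℝ)) :
    ρ f = ρ (f ⊔ 0) - ρ ((-f) ⊔ 0) := by
  have h1 : f ⊔ 0 ∈ singlyGenerated f :=
    ⟨⟨fun t => max t 0, by fun_prop⟩, by simp, fun x => by simp⟩
  have h2 : (-f) ⊔ 0 ∈ singlyGenerated f :=
    ⟨⟨fun t => max (-t) 0, by fun_prop⟩, by simp, fun x => by simp⟩
  rw [← ρ.map_sub h1 h2]
  congr 1
  ext x
  simp only [CompactlySupportedContinuousMap.sub_apply, CompactlySupportedContinuousMap.sup_apply,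
    CompactlySupportedContinuousMap.neg_apply, CompactlySupportedContinuousMap.zero_apply]
  rcases le_total (f x) 0 with h | h
  · rw [max_eq_right h, max_eq_left (by linarith)]; ring
  · rw [max_eq_left h, max_eq_right (by linarith)]; ring

/-- The truncation `min f c`. -/
noncomputable def clip (f : C_c(X, ℝ)) (c : ℝ) : C_c(X, ℝ) := f.compLeft ⟨fun t => min t c, by fun_prop⟩

theorem clip_apply (f : C_c(X, ℝ)) {c : ℝ} (hc : 0 ≤ c) (x : X) :
    clip f c x = min (f x) c := by
  unfold clip
  rw [CompactlySupportedContinuousMap.compLeft_apply (by simp [hc])]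
  rfl

theorem clip_mem (f : C_c(X, ℝ)) {c : ℝ} (hc : 0 ≤ c) : clip f c ∈ singlyGenerated f :=
  ⟨⟨fun t => min t c, by fun_prop⟩, by simp [hc], fun x => clip_apply f hc x⟩

theorem exists_bound (f : C_c(X, ℝ)) : ∃ C : ℝ, ∀ x, f x ≤ C := by
  obtain ⟨C, hC⟩ := f.continuous.bounded_above_of_compact_support f.hasCompactSupport
  exact ⟨C, fun x => (le_abs_self _).trans (hC x)⟩

theorem clip_step (ρ : QuasiIntegral X) {f g : C_c(X, ℝ)} (hfg : ∀ x, f x ≤ g x)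
    {ε : ℝ} (hε : 0 < ε) (hg : ∀ x, 0 ≤ g x) (n : ℕ) :
    ρ (clip f ((n + 1) * ε)) - ρ (clip f ε) ≤ ρ (clip g (n * ε)) := by
  induction n with
  | zero =>
    have h : clip g ((0 : ℕ) * ε) = 0 := by
      ext x; rw [clip_apply _ (by simp)]; simp [hg x]
    rw [h, ρ.map_zero]; simp
  | succ n ih =>
    have p0 : 0 ≤ (n : ℝ) * ε := by positivity
    have p1 : 0 ≤ ((n : ℝ) + 1) * ε := by positivity
    have p2 : 0 ≤ ((n : ℝ) + 1 + 1) * ε := by positivity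
    have e1 := ρ.map_sub (clip_mem f p2) (clip_mem f p1)
    have e2 := ρ.map_sub (clip_mem g p1) (clip_mem g p0)
    have e3 : ρ (clip f (((n : ℝ) + 1 + 1) * ε) - clip f (((n : ℝ) + 1) * ε)) ≤
        ρ (clip g (((n : ℝ) + 1) * ε) - clip g ((n : ℝ) * ε)) := by
      have key : ∀ x, clip f (((n : ℝ) + 1 + 1) * ε) x - clip f (((n : ℝ) + 1) * ε) x ≠ 0 →
          clip g (((n : ℝ) + 1) * ε) x - clip g ((n : ℝ) * ε) x = ε := by
        intro x hx
        rw [clip_apply _ p1, clip_apply _ p2] at hx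
        rw [clip_apply _ p1, clip_apply _ p0]
        have : ((n : ℝ) + 1) * ε < f x := by
          by_contra! hle
          rw [min_eq_left hle, min_eq_left (by nlinarith)] at hx
          simp at hx
        have h2 := hfg x
        rw [min_eq_right (by linarith), min_eq_right (by nlinarith)]
        ring
      have hu : ∀ x, 0 ≤ (clip f (((n : ℝ) + 1 + 1) * ε) - clip f (((n : ℝ) + 1) * ε)) x := by
        intro x
        rw [CompactlySupportedContinuousMap.sub_apply, clip_apply _ p1, clip_apply _ p2, sub_nonneg]
        exact min_le_min_left _ (by nlinarith)
      have hu' : ∀ x, (clip f (((n : ℝ) + 1 + 1) * ε) - clip f (((n : ℝ) + 1) * ε)) x ≤ ε := by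
        intro x
        rw [CompactlySupportedContinuousMap.sub_apply, clip_apply _ p1, clip_apply _ p2]
        rcases le_total (f x) (((n : ℝ) + 1) * ε) with h | h
        · rw [min_eq_left h, min_eq_left (by nlinarith)]; linarith
        · rw [min_eq_right h]
          have := min_le_right (f x) (((n : ℝ) + 1 + 1) * ε)
          linarith
      have hv0 : ∀ x, 0 ≤ (clip g (((n : ℝ) + 1) * ε) - clip g ((n : ℝ) * ε)) x := by
        intro x
        rw [CompactlySupportedContinuousMap.sub_apply, clip_apply _ p1, clip_apply _ p0, sub_nonneg]
        exact min_le_min_left _ (by nlinarith)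
      have hv : ∀ x, (clip g (((n : ℝ) + 1) * ε) - clip g ((n : ℝ) * ε)) x ≤ ε := by
        intro x
        rw [CompactlySupportedContinuousMap.sub_apply, clip_apply _ p1, clip_apply _ p0]
        rcases le_total (g x) ((n : ℝ) * ε) with h | h
        · rw [min_eq_left h, min_eq_left (by nlinarith)]; linarith
        · rw [min_eq_right h]
          have := min_le_right (g x) (((n : ℝ) + 1) * ε)
          linarith
      refine ρ.map_le_of_stack hε.le hu hv key fun x => ?_
      by_cases hx : (clip f (((n : ℝ) + 1 + 1) * ε) - clip f (((n : ℝ) + 1) * ε)) x = 0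
      · rw [hx]; exact hv0 x
      · exact (hu' x).trans (key x hx).ge
    push_cast
    linarith

theorem map_le_of_eq_one (ρ : QuasiIntegral X) {f w : C_c(X, ℝ)} {c : ℝ} (hc : 0 ≤ c)
    (hf : ∀ x, 0 ≤ f x) (hfc : ∀ x, f x ≤ c) (hw : ∀ x, 0 ≤ w x) (hw1 : ∀ x, w x ≤ 1)
    (h : ∀ x, f x ≠ 0 → w x = 1) : ρ f ≤ c * ρ w := by
  rw [← ρ.map_smul]
  refine ρ.map_le_of_stack hc hf (fun x => ?_) (fun x hx => by simp [h x hx]) fun x => ?_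
  · simpa using mul_le_mul_of_nonneg_left (hw1 x) hc
  · by_cases hx : f x = 0
    · simpa [hx] using mul_nonneg hc (hw x)
    · simpa [h x hx] using hfc x

theorem map_add_of_mul_eq_zero (ρ : QuasiIntegral X) {f g : C_c(X, ℝ)} (hf : ∀ x, 0 ≤ f x)
    (hg : ∀ x, 0 ≤ g x) (h : ∀ x, f x = 0 ∨ g x = 0) : ρ (f + g) = ρ f + ρ g := by
  refine ρ.map_add (f := f - g) ⟨⟨fun t => max t 0, by fun_prop⟩, by simp, fun x => ?_⟩
    ⟨⟨fun t => max (-t) 0, by fun_prop⟩, by simp, fun x => ?_⟩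
  · rcases h x with hx | hx <;> simp [hx, hf x, hg x]
  · rcases h x with hx | hx <;> simp [hx, hf x, hg x]

/-! The topological measure of a quasi-integral. -/

/-- `sup {ρ(f) : f ∈ C_c(X), 0 ≤ f ≤ 1, supp f ⊆ U}`. -/
noncomputable def openValue (ρ : QuasiIntegral X) (U : Set X) : ℝ≥0∞ :=
  ⨆ (f : C_c(X, ℝ)) (_ : (∀ x, 0 ≤ f x ∧ f x ≤ 1) ∧ tsupport f ⊆ U), ENNReal.ofReal (ρ f)

/-- `inf {ρ.openValue U : U open, A ⊆ U}`; on open sets this is `ρ.openValue` itself, see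
`setValue_of_isOpen`. -/
noncomputable def setValue (ρ : QuasiIntegral X) (A : Set X) : ℝ≥0∞ :=
  ⨅ (U : Set X) (_ : IsOpen U ∧ A ⊆ U), ρ.openValue U

theorem le_openValue (ρ : QuasiIntegral X) {U : Set X} {f : C_c(X, ℝ)}
    (hf : ∀ x, 0 ≤ f x ∧ f x ≤ 1) (hfU : tsupport f ⊆ U) :
    ENNReal.ofReal (ρ f) ≤ ρ.openValue U :=
  le_iSup₂_of_le f ⟨hf, hfU⟩ le_rfl

theorem openValue_mono (ρ : QuasiIntegral X) {U V : Set X} (h : U ⊆ V) :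
    ρ.openValue U ≤ ρ.openValue V :=
  iSup₂_le fun _ hf => ρ.le_openValue hf.1 (hf.2.trans h)

theorem setValue_of_isOpen (ρ : QuasiIntegral X) {U : Set X} (hU : IsOpen U) :
    ρ.setValue U = ρ.openValue U :=
  le_antisymm (iInf₂_le_of_le U ⟨hU, subset_rfl⟩ le_rfl)
    (le_iInf₂ fun _ hV => ρ.openValue_mono hV.2)

theorem setValue_le (ρ : QuasiIntegral X) {A U : Set X} (hU : IsOpen U) (h : A ⊆ U) :
    ρ.setValue A ≤ ρ.openValue U :=
  iInf₂_le_of_le U ⟨hU, h⟩ le_rfl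

theorem setValue_mono (ρ : QuasiIntegral X) {A B : Set X} (h : A ⊆ B) :
    ρ.setValue A ≤ ρ.setValue B :=
  le_iInf₂ fun _ hU => ρ.setValue_le hU.1 (h.trans hU.2)

theorem tsupport_zero_subset (U : Set X) : tsupport (0 : C_c(X, ℝ)) ⊆ U := by
  simp [tsupport]

theorem openValue_add_le (ρ : QuasiIntegral X) {U V : Set X} (hd : Disjoint U V) :
    ρ.openValue U + ρ.openValue V ≤ ρ.openValue (U ∪ V) := by
  refine ENNReal.biSup_add_biSup_le' ⟨0, by simp, tsupport_zero_subset U⟩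
    ⟨0, by simp, tsupport_zero_subset V⟩ fun f hf g hg => ?_
  have h0 : ∀ x, f x = 0 ∨ g x = 0 := by
    intro x
    by_contra! h
    exact Set.disjoint_left.mp hd (hf.2 (subset_tsupport _ h.1)) (hg.2 (subset_tsupport _ h.2))
  have hf0 : ∀ x, 0 ≤ f x := fun x => (hf.1 x).1
  have hg0 : ∀ x, 0 ≤ g x := fun x => (hg.1 x).1
  rw [← ENNReal.ofReal_add (ρ.nonneg hf0) (ρ.nonneg hg0), ← ρ.map_add_of_mul_eq_zero hf0 hg0 h0]
  refine ρ.le_openValue (fun x => ?_)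
    ((tsupport_add (f : X → ℝ) g).trans (Set.union_subset_union hf.2 hg.2))
  rcases h0 x with h | h
  · simpa [h] using hg.1 x
  · simpa [h] using hf.1 x

end basic

section lc

variable {X : Type*} [TopologicalSpace X] [T2Space X] [LocallyCompactSpace X]

/-- Urysohn function for a compact set inside an open set; it is `1` near the compact set. -/
theorem exists_urysohn {K U : Set X} (hK : IsCompact K) (hU : IsOpen U) (hKU : K ⊆ U) :
    ∃ w : C_c(X, ℝ), (∀ x, 0 ≤ w x ∧ w x ≤ 1) ∧ tsupport w ⊆ U ∧
      ∃ V : Set X, IsOpen V ∧ K ⊆ V ∧ ∀ x ∈ V, w x = 1 := by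
  obtain ⟨L, hL, hKL, hLU⟩ := exists_compact_between hK hU hKU
  obtain ⟨M, hM, hLM, hMU⟩ := exists_compact_between hL hU hLU
  obtain ⟨f, hf1, hf0, hfc, hf⟩ := exists_continuous_one_zero_of_isCompact hL
    isOpen_interior.isClosed_compl (Set.disjoint_compl_right_iff_subset.mpr hLM)
  refine ⟨⟨f, hfc⟩, fun x => hf x, ?_, interior L, isOpen_interior, hKL,
    fun x hx => hf1 (interior_subset hx)⟩
  refine subset_trans (closure_minimal (fun x hx => ?_) hM.isClosed) hMU
  by_contra hxM
  exact hx (hf0 fun h => hxM (interior_subset h))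

theorem mono (ρ : QuasiIntegral X) {f g : C_c(X, ℝ)} (hf : ∀ x, 0 ≤ f x)
    (hfg : ∀ x, f x ≤ g x) : ρ f ≤ ρ g := by
  obtain ⟨w, hw, -, V, -, hV, hV1⟩ :=
    exists_urysohn f.hasCompactSupport isOpen_univ (Set.subset_univ _)
  have hw1 : ∀ x, f x ≠ 0 → w x = 1 := fun x hx => hV1 x (hV (subset_tsupport _ hx))
  have hwn : 0 ≤ ρ w := ρ.nonneg fun x => (hw x).1
  have key : ∀ ε : ℝ, 0 < ε → ρ f ≤ ρ g + ε * ρ w := by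
    intro ε hε
    obtain ⟨C, hC⟩ := exists_bound g
    obtain ⟨n, hn⟩ := exists_nat_ge (C / ε)
    rw [div_le_iff₀ hε] at hn
    have h1 := clip_step ρ hfg hε (fun x => (hf x).trans (hfg x)) n
    have e1 : clip f ((n + 1) * ε) = f := by
      ext x
      rw [clip_apply _ (by positivity), min_eq_left]
      nlinarith [hfg x, hC x]
    have e2 : clip g (n * ε) = g := by
      ext x
      rw [clip_apply _ (by positivity), min_eq_left]
      nlinarith [hC x]
    rw [e1, e2] at h1
    have h2 : ρ (clip f ε) ≤ ε * ρ w := by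
      refine ρ.map_le_of_eq_one hε.le (fun x => ?_) (fun x => ?_) (fun x => (hw x).1)
        (fun x => (hw x).2) fun x hx => hw1 x fun h0 => hx ?_
      · rw [clip_apply _ hε.le]; exact le_min (hf x) hε.le
      · rw [clip_apply _ hε.le]; exact min_le_right _ _
      · rw [clip_apply _ hε.le, h0, min_eq_left hε.le]
    linarith
  by_contra! hlt
  have h1 := key ((ρ f - ρ g) / (2 * (ρ w + 1))) (by apply div_pos <;> linarith)
  have h2 : (ρ f - ρ g) / (2 * (ρ w + 1)) * ρ w ≤ (ρ f - ρ g) / 2 := by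
    rw [div_mul_eq_mul_div, div_le_div_iff₀ (by linarith) (by norm_num)]
    nlinarith
  linarith

theorem le_add_of_le (ρ : QuasiIntegral X) {f g w : C_c(X, ℝ)} {ε : ℝ} (hε : 0 ≤ ε)
    (hf : ∀ x, 0 ≤ f x) (hg : ∀ x, 0 ≤ g x) (hw : ∀ x, 0 ≤ w x ∧ w x ≤ 1)
    (hgw : ∀ x, g x ≠ 0 → w x = 1) (hfw : ∀ x, f x ≠ 0 → w x = 1) (h : ∀ x, f x ≤ g x + ε) :
    ρ f ≤ ρ g + ε * ρ w := by
  have h1 : ρ (g + ε • w) = ρ g + ρ (ε • w) := by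
    refine ρ.map_add_of_stack hε hg (fun x => ?_) fun x hx => by simp [hgw x hx]
    simpa using mul_le_mul_of_nonneg_left (hw x).2 hε
  rw [← ρ.map_smul, ← h1]
  refine ρ.mono hf fun x => ?_
  by_cases hx : f x = 0
  · rw [hx]
    simpa using add_nonneg (hg x) (mul_nonneg hε (hw x).1)
  · simpa [hfw x hx] using h x

/-- Quasi-integrals are Lipschitz on functions supported in a common compact set. -/
theorem abs_sub_le (ρ : QuasiIntegral X) {f g w : C_c(X, ℝ)} {ε : ℝ} (hε : 0 ≤ ε)
    (hw : ∀ x, 0 ≤ w x ∧ w x ≤ 1) (hgw : ∀ x, g x ≠ 0 → w x = 1)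
    (hfw : ∀ x, f x ≠ 0 → w x = 1) (h : ∀ x, |f x - g x| ≤ ε) :
    |ρ f - ρ g| ≤ 2 * ε * ρ w := by
  have pos : ∀ (k : C_c(X, ℝ)) (x : X), 0 ≤ (k ⊔ 0) x := fun k x => by simp
  have nz : ∀ (k : C_c(X, ℝ)), (∀ x, k x ≠ 0 → w x = 1) → ∀ x, (k ⊔ 0) x ≠ 0 → w x = 1 :=
    fun k hk x hx => hk x fun h0 => hx (by simp [h0])
  have nz' : ∀ (k : C_c(X, ℝ)), (∀ x, k x ≠ 0 → w x = 1) → ∀ x, (-k) x ≠ 0 → w x = 1 :=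
    fun k hk x hx => hk x fun h0 => hx (by simp [h0])
  have cmp : ∀ k l : C_c(X, ℝ), (∀ x, k x ≠ 0 → w x = 1) → (∀ x, l x ≠ 0 → w x = 1) →
      (∀ x, k x ≤ l x + ε) → ρ (k ⊔ 0) ≤ ρ (l ⊔ 0) + ε * ρ w := by
    intro k l hk hl hkl
    refine ρ.le_add_of_le hε (pos k) (pos l) hw (nz l hl) (nz k hk) fun x => ?_
    simp only [CompactlySupportedContinuousMap.sup_apply,
      CompactlySupportedContinuousMap.zero_apply]
    refine max_le ((hkl x).trans ?_) (add_nonneg (le_max_right _ _) hε)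
    linarith [le_max_left (l x) 0]
  have a1 := cmp f g hfw hgw fun x => by linarith [(abs_le.mp (h x)).2]
  have a2 := cmp g f hgw hfw fun x => by linarith [(abs_le.mp (h x)).1]
  have a3 := cmp (-f) (-g) (nz' f hfw) (nz' g hgw) fun x => by
    simp only [CompactlySupportedContinuousMap.neg_apply]; linarith [(abs_le.mp (h x)).1]
  have a4 := cmp (-g) (-f) (nz' g hgw) (nz' f hfw) fun x => by
    simp only [CompactlySupportedContinuousMap.neg_apply]; linarith [(abs_le.mp (h x)).2]
  rw [ρ.map_eq_pos_sub_neg f, ρ.map_eq_pos_sub_neg g, abs_le]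
  constructor <;> linarith

theorem continuous_apply_family {Y : Type*} [TopologicalSpace Y] (ρ : QuasiIntegral X)
    (F : Y → C_c(X, ℝ))
    (hF : Continuous fun p : Y × X => F p.1 p.2) {K : Set X} (hK : IsCompact K)
    (hFK : ∀ y x, x ∉ K → F y x = 0) : Continuous fun y => ρ (F y) := by
  obtain ⟨w, hw, -, V, -, hKV, hV⟩ := exists_urysohn hK isOpen_univ (Set.subset_univ _)
  have hw1 : ∀ y x, F y x ≠ 0 → w x = 1 := fun y x hx => hV x (hKV (by
    by_contra h; exact hx (hFK y x h)))
  have hwn : 0 ≤ ρ w := ρ.nonneg fun x => (hw x).1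
  refine continuous_iff_continuousAt.mpr fun y₀ => Metric.tendsto_nhds.mpr fun ε hε => ?_
  have hδ : 0 < ε / (2 * (ρ w + 1)) := by apply div_pos hε; linarith
  have key : ∀ᶠ y in nhds y₀, ∀ x ∈ K, |F y x - F y₀ x| < ε / (2 * (ρ w + 1)) := by
    refine hK.eventually_forall_of_forall_eventually fun x _ => ?_
    have hc : Continuous fun p : Y × X => |F p.1 p.2 - F y₀ p.2| := by
      have : Continuous fun p : Y × X => F y₀ p.2 := by fun_prop
      exact (hF.sub this).abs
    exact hc.continuousAt.eventually_lt continuousAt_const (by simpa using hδ)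
  filter_upwards [key] with y hy
  have h := ρ.abs_sub_le (f := F y) (g := F y₀) hδ.le hw (hw1 y₀) (hw1 y) fun x => by
    by_cases hx : x ∈ K
    · exact (hy x hx).le
    · rw [hFK y x hx, hFK y₀ x hx]; simpa using hδ.le
  rw [Real.dist_eq]
  refine h.trans_lt ?_
  have h2 : 2 * (ε / (2 * (ρ w + 1))) * ρ w = ε * (ρ w / (ρ w + 1)) := by
    field_simp
  have h3 : ρ w / (ρ w + 1) < 1 := by rw [div_lt_one (by linarith)]; linarith
  rw [h2]
  nlinarith

theorem setValue_lt_top (ρ : QuasiIntegral X) {K : Set X} (hK : IsCompact K) :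
    ρ.setValue K < ∞ := by
  obtain ⟨w, hw, -, V, hVo, hKV, hV⟩ := exists_urysohn hK isOpen_univ (Set.subset_univ _)
  refine (iInf₂_le_of_le V ⟨hVo, hKV⟩ (iSup₂_le fun f hf => ?_) :
    ρ.setValue K ≤ ENNReal.ofReal (ρ w)).trans_lt ENNReal.ofReal_lt_top
  refine ENNReal.ofReal_le_ofReal (ρ.mono (fun x => (hf.1 x).1) fun x => ?_)
  by_cases hx : f x = 0
  · rw [hx]; exact (hw x).1
  · rw [hV x (hf.2 (subset_tsupport _ hx))]; exact (hf.1 x).2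

theorem openValue_union (ρ : QuasiIntegral X) {U V : Set X} (hU : IsOpen U) (hV : IsOpen V)
    (hd : Disjoint U V) : ρ.openValue (U ∪ V) = ρ.openValue U + ρ.openValue V := by
  refine le_antisymm (iSup₂_le fun f hf => ?_) (ρ.openValue_add_le hd)
  have piece : ∀ A B : Set X, IsOpen A → IsOpen B → tsupport f ⊆ A ∪ B →
      ∃ g : C_c(X, ℝ), (∀ x, 0 ≤ g x ∧ g x ≤ 1) ∧ tsupport g ⊆ A ∧
        ∀ x, x ∉ B → g x = f x := by
    intro A B hA hB hfAB
    have hsub : tsupport f \ B ⊆ A := fun x hx => (hfAB hx.1).resolve_right hx.2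
    obtain ⟨w, hw, hwA, N, -, hN, hN1⟩ := exists_urysohn (f.hasCompactSupport.diff hB) hA hsub
    refine ⟨f * w, fun x => ?_, (tsupport_mul_subset_right (f := f) (g := w)).trans hwA,
      fun x hx => ?_⟩
    · exact ⟨mul_nonneg (hf.1 x).1 (hw x).1, mul_le_one₀ (hf.1 x).2 (hw x).1 (hw x).2⟩
    · by_cases hxf : f x = 0
      · simp [hxf]
      · simp [hN1 x (hN ⟨subset_tsupport _ hxf, hx⟩)]
  obtain ⟨g, hg, hgU, hgf⟩ := piece U V hU hV hf.2
  obtain ⟨k, hk, hkV, hkf⟩ := piece V U hV hU (by rw [Set.union_comm]; exact hf.2)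
  have hgz : ∀ x, x ∉ U → g x = 0 := fun x hx => by
    by_contra h; exact hx (hgU (subset_tsupport _ h))
  have hkz : ∀ x, x ∉ V → k x = 0 := fun x hx => by
    by_contra h; exact hx (hkV (subset_tsupport _ h))
  have hUV : ∀ x, x ∈ U → x ∉ V := fun _ hx => Set.disjoint_left.mp hd hx
  have e : f = g + k := by
    ext x
    rw [CompactlySupportedContinuousMap.add_apply]
    by_cases hx : x ∈ U
    · rw [hgf x (hUV x hx), hkz x (hUV x hx), add_zero]
    · rw [hkf x hx, hgz x hx, zero_add]
  have hg0 : ∀ x, 0 ≤ g x := fun x => (hg x).1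
  have hk0 : ∀ x, 0 ≤ k x := fun x => (hk x).1
  have h0 : ∀ x, g x = 0 ∨ k x = 0 := fun x => by
    by_cases hx : x ∈ U
    · exact Or.inr (hkz x (hUV x hx))
    · exact Or.inl (hgz x hx)
  rw [e, ρ.map_add_of_mul_eq_zero hg0 hk0 h0, ENNReal.ofReal_add (ρ.nonneg hg0) (ρ.nonneg hk0)]
  exact add_le_add (ρ.le_openValue hg hgU) (ρ.le_openValue hk hkV)

theorem setValue_union_of_isCompact (ρ : QuasiIntegral X) {K C : Set X} (hK : IsCompact K)
    (hC : IsCompact C) (hd : Disjoint K C) :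
    ρ.setValue (K ∪ C) = ρ.setValue K + ρ.setValue C := by
  obtain ⟨U, V, hU, hV, hKU, hCV, hUV⟩ := SeparatedNhds.of_isCompact_isCompact hK hC hd
  apply le_antisymm
  · simp only [setValue, ENNReal.iInf_add, ENNReal.add_iInf]
    refine le_iInf₂ fun B hB => le_iInf₂ fun A hA => ?_
    refine iInf₂_le_of_le (A ∩ U ∪ B ∩ V)
      ⟨(hA.1.inter hU).union (hB.1.inter hV), Set.union_subset_union
        (Set.subset_inter hA.2 hKU) (Set.subset_inter hB.2 hCV)⟩ ?_
    rw [ρ.openValue_union (hA.1.inter hU) (hB.1.inter hV)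
      (hUV.mono Set.inter_subset_right Set.inter_subset_right)]
    exact add_le_add (ρ.openValue_mono Set.inter_subset_left)
      (ρ.openValue_mono Set.inter_subset_left)
  · refine le_iInf₂ fun W hW => ?_
    have hKW : K ⊆ W := Set.subset_union_left.trans hW.2
    have hCW : C ⊆ W := Set.subset_union_right.trans hW.2
    calc ρ.setValue K + ρ.setValue C
        ≤ ρ.openValue (W ∩ U) + ρ.openValue (W ∩ V) :=
          add_le_add (ρ.setValue_le (hW.1.inter hU) (Set.subset_inter hKW hKU))
            (ρ.setValue_le (hW.1.inter hV) (Set.subset_inter hCW hCV))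
      _ ≤ ρ.openValue (W ∩ U ∪ W ∩ V) :=
          ρ.openValue_add_le (hUV.mono Set.inter_subset_right Set.inter_subset_right)
      _ ≤ ρ.openValue W :=
          ρ.openValue_mono (Set.union_subset Set.inter_subset_left Set.inter_subset_left)

theorem openValue_compact_union (ρ : QuasiIntegral X) {K U : Set X} (hK : IsCompact K)
    (hd : Disjoint K U) (hW : IsOpen (K ∪ U)) :
    ρ.openValue (K ∪ U) = ρ.setValue K + ρ.openValue U := by
  apply le_antisymm
  · simp only [setValue, ENNReal.iInf_add]
    refine le_iInf₂ fun V hV => iSup₂_le fun f hf => ?_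
    obtain ⟨g, hg, hgV, N, hN, hKN, hgN⟩ := exists_urysohn hK (hV.1.inter hW)
      (Set.subset_inter hV.2 Set.subset_union_left)
    obtain ⟨w, hw, hwW, M, -, hM, hwM⟩ :=
      exists_urysohn (f.hasCompactSupport.isCompact.union g.hasCompactSupport.isCompact) hW
        (Set.union_subset hf.2 (hgV.trans Set.inter_subset_right))
    have hw1 : ∀ x, x ∈ tsupport f ∪ tsupport g → w x = 1 := fun x hx => hwM x (hM hx)
    have h1 : ρ f ≤ ρ w := ρ.mono (fun x => (hf.1 x).1) fun x => by
      by_cases hx : f x = 0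
      · rw [hx]; exact (hw x).1
      · rw [hw1 x (Or.inl (subset_tsupport _ hx))]; exact (hf.1 x).2
    have hgw : ∀ x, g x ≠ 0 → w x = 1 := fun x hx => hw1 x (Or.inr (subset_tsupport _ hx))
    have hwg : ∀ x, g x ≤ w x := fun x => by
      by_cases hx : g x = 0
      · rw [hx]; exact (hw x).1
      · rw [hgw x hx]; exact (hg x).2
    obtain ⟨m1, m2⟩ := stack_mem zero_le_one (fun x => (hg x).1) (fun x => (hw x).2) hgw
    have h2 : ρ w = ρ g + ρ (w - g) := by rw [ρ.map_sub m2 m1]; ring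
    have hd0 : ∀ x, 0 ≤ (w - g) x := fun x => by simpa using hwg x
    have hs1 : tsupport (w - g) ⊆ Nᶜ := by
      refine closure_minimal (fun x hx hxN => hx ?_) hN.isClosed_compl
      have hgx := hgN x hxN
      have : w x = 1 := hgw x (by rw [hgx]; exact one_ne_zero)
      simp [hgx, this]
    have hs2 : tsupport (w - g) ⊆ K ∪ U := by
      refine (tsupport_sub (w : X → ℝ) g).trans (Set.union_subset hwW ?_)
      exact hgV.trans Set.inter_subset_right
    have h3 : ENNReal.ofReal (ρ (w - g)) ≤ ρ.openValue U := by
      refine ρ.le_openValue (fun x => ⟨hd0 x, ?_⟩) fun x hx =>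
        (hs2 hx).resolve_left fun hxK => hs1 hx (hKN hxK)
      rw [CompactlySupportedContinuousMap.sub_apply]
      linarith [(hw x).2, (hg x).1]
    calc ENNReal.ofReal (ρ f) ≤ ENNReal.ofReal (ρ g + ρ (w - g)) :=
          ENNReal.ofReal_le_ofReal (h1.trans h2.le)
      _ = ENNReal.ofReal (ρ g) + ENNReal.ofReal (ρ (w - g)) :=
          ENNReal.ofReal_add (ρ.nonneg fun x => (hg x).1) (ρ.nonneg hd0)
      _ ≤ _ := add_le_add (ρ.le_openValue hg (hgV.trans Set.inter_subset_left)) h3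
  · conv_lhs => rw [openValue]
    rw [ENNReal.add_biSup' ⟨0, by simp, tsupport_zero_subset U⟩]
    refine iSup₂_le fun f hf => ?_
    have hVo : IsOpen ((K ∪ U) \ tsupport f) := hW.sdiff (isClosed_tsupport f)
    have hKV : K ⊆ (K ∪ U) \ tsupport f := fun x hx =>
      ⟨Or.inl hx, fun hxf => Set.disjoint_left.mp hd hx (hf.2 hxf)⟩
    calc ρ.setValue K + ENNReal.ofReal (ρ f)
        ≤ ρ.openValue ((K ∪ U) \ tsupport f) + ρ.openValue (tsupport f) :=
          add_le_add (ρ.setValue_le hVo hKV) (ρ.le_openValue hf.1 subset_rfl)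
      _ ≤ ρ.openValue ((K ∪ U) \ tsupport f ∪ tsupport f) :=
          ρ.openValue_add_le Set.disjoint_sdiff_left
      _ ≤ ρ.openValue (K ∪ U) := ρ.openValue_mono
          (Set.union_subset Set.sdiff_subset (hf.2.trans Set.subset_union_right))

theorem setValue_compact_union (ρ : QuasiIntegral X) {K U : Set X} (hK : IsCompact K)
    (hU : IsOpen U) (hd : Disjoint K U) (hKU : IsCompact (K ∪ U) ∨ IsOpen (K ∪ U)) :
    ρ.setValue (K ∪ U) = ρ.setValue K + ρ.setValue U := by
  rw [ρ.setValue_of_isOpen hU]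
  rcases hKU with hC | hW
  · obtain ⟨W, hW, hCW, -, hWc⟩ := exists_open_between_and_isCompact_closure hC isOpen_univ
      (Set.subset_univ _)
    have e1 : W = (K ∪ U) ∪ W \ (K ∪ U) := (Set.union_sdiff_cancel hCW).symm
    have hKW : K ⊆ W := Set.subset_union_left.trans hCW
    have e2 : W = K ∪ W \ K := (Set.union_sdiff_cancel hKW).symm
    have e3 : W \ K = U ∪ W \ (K ∪ U) := by
      ext x
      have h1 : x ∈ K → x ∉ U := fun h => Set.disjoint_left.mp hd h
      have h2 : x ∈ U → x ∈ W := fun h => hCW (Or.inr h)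
      simp only [Set.mem_sdiff, Set.mem_union]
      tauto
    have a1 := ρ.openValue_compact_union hC Set.disjoint_sdiff_right (by rwa [← e1])
    have a2 := ρ.openValue_compact_union hK Set.disjoint_sdiff_right (by rwa [← e2])
    rw [← e1] at a1
    rw [← e2, e3, ρ.openValue_union hU (hW.sdiff hC.isClosed)
      (Set.disjoint_sdiff_right.mono_left Set.subset_union_right), ← add_assoc] at a2
    have hfin : ρ.openValue (W \ (K ∪ U)) ≠ ∞ := by
      rw [← ρ.setValue_of_isOpen (hW.sdiff hC.isClosed)]
      exact ((ρ.setValue_mono (Set.sdiff_subset.trans subset_closure)).trans_lt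
        (ρ.setValue_lt_top hWc)).ne
    exact (ENNReal.add_left_inj hfin).mp (a1.symm.trans a2)
  · rw [ρ.setValue_of_isOpen hW, ρ.openValue_compact_union hK hd hW]

/-- The topological measure corresponding to the quasi-integral `ρ`:
`μ(U) = sup {ρ(f) : f ∈ C_c(X), 0 ≤ f ≤ 1, supp f ⊆ U}` for open `U`, and
`μ(F) = inf {μ(U) : U open, F ⊆ U}` for closed `F`. -/
noncomputable def topologicalMeasure (ρ : QuasiIntegral X) : TopologicalMeasure X where
  toFun := ρ.setValue
  union' A B hd hA hB hAB := by
    rcases hA with hA | hA <;> rcases hB with hB | hB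
    · exact ρ.setValue_union_of_isCompact hA hB hd
    · exact ρ.setValue_compact_union hA hB hd hAB
    · rw [Set.union_comm, add_comm]
      exact ρ.setValue_compact_union hB hA hd.symm (by rwa [Set.union_comm])
    · rw [ρ.setValue_of_isOpen hA, ρ.setValue_of_isOpen hB, ρ.setValue_of_isOpen (hA.union hB)]
      exact ρ.openValue_union hA hB hd
  inner' U hU := by
    apply le_antisymm
    · rw [ρ.setValue_of_isOpen hU]
      refine iSup₂_le fun f hf => le_iSup₂_of_le (tsupport f) ⟨f.hasCompactSupport, hf.2⟩ ?_
      exact le_iInf₂ fun V hV => ρ.le_openValue hf.1 hV.2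
    · exact iSup₂_le fun K hK => ρ.setValue_mono hK.2
  outer' F _ := iInf_congr fun _ => iInf_congr fun hU => (ρ.setValue_of_isOpen hU.1).symm

/-- The topological measure corresponding to a quasi-integral is compact-finite. -/
theorem topologicalMeasure_compactFinite (ρ : QuasiIntegral X) :
    ρ.topologicalMeasure.CompactFinite := fun _ hK => ρ.setValue_lt_top hK

end lc

section product

variable {X Y : Type*} [TopologicalSpace X] [TopologicalSpace Y] [T2Space X] [T2Space Y]

/-- The function `f_y(x) = f(x, y)` on `X`. -/
def fiberX (f : C_c(X × Y, ℝ)) (y : Y) : C_c(X, ℝ) where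
  toFun x := f (x, y)
  continuous_toFun := by fun_prop
  hasCompactSupport' := by
    refine HasCompactSupport.intro (f.hasCompactSupport.isCompact.image continuous_fst)
      fun x hx => ?_
    by_contra h
    exact hx ⟨(x, y), subset_tsupport _ h, rfl⟩

/-- The function `f_x(y) = f(x, y)` on `Y`. -/
def fiberY (f : C_c(X × Y, ℝ)) (x : X) : C_c(Y, ℝ) where
  toFun y := f (x, y)
  continuous_toFun := by fun_prop
  hasCompactSupport' := by
    refine HasCompactSupport.intro (f.hasCompactSupport.isCompact.image continuous_snd)
      fun y hy => ?_
    by_contra h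
    exact hy ⟨(x, y), subset_tsupport _ h, rfl⟩

/-- The function `T_ρ(f)(y) = ρ(f_y)` on `Y`. -/
def T [LocallyCompactSpace X] (ρ : QuasiIntegral X) (f : C_c(X × Y, ℝ)) : C_c(Y, ℝ) where
  toFun y := ρ (fiberX f y)
  continuous_toFun := by
    refine ρ.continuous_apply_family (fiberX f) (f.continuous.comp continuous_swap)
      (f.hasCompactSupport.isCompact.image continuous_fst) fun y x hx => ?_
    by_contra h
    exact hx ⟨(x, y), subset_tsupport _ h, rfl⟩
  hasCompactSupport' := by
    refine HasCompactSupport.intro (f.hasCompactSupport.isCompact.image continuous_snd)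
      fun y hy => ?_
    have : fiberX f y = 0 := by
      ext x
      by_contra h
      exact hy ⟨(x, y), subset_tsupport _ h, rfl⟩
    rw [this, ρ.map_zero]

/-- The function `S_η(f)(x) = η(f_x)` on `X`. -/
def S [LocallyCompactSpace Y] (η : QuasiIntegral Y) (f : C_c(X × Y, ℝ)) : C_c(X, ℝ) where
  toFun x := η (fiberY f x)
  continuous_toFun := by
    refine η.continuous_apply_family (fiberY f) f.continuous
      (f.hasCompactSupport.isCompact.image continuous_snd) fun x y hy => ?_
    by_contra h
    exact hy ⟨(x, y), subset_tsupport _ h, rfl⟩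
  hasCompactSupport' := by
    refine HasCompactSupport.intro (f.hasCompactSupport.isCompact.image continuous_fst)
      fun x hx => ?_
    have : fiberY f x = 0 := by
      ext y
      by_contra h
      exact hx ⟨(x, y), subset_tsupport _ h, rfl⟩
    rw [this, η.map_zero]

/-- The repeated quasi-integral `η × ρ` on `C_c(X × Y)`, `(η × ρ)(f) = η(T_ρ(f))`. -/
def iterXY [LocallyCompactSpace X] (η : QuasiIntegral Y) (ρ : QuasiIntegral X)
    (f : C_c(X × Y, ℝ)) : ℝ := η (T ρ f)

/-- The repeated quasi-integral `ρ × η` on `C_c(X × Y)`, `(ρ × η)(f) = ρ(S_η(f))`. -/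
def iterYX [LocallyCompactSpace Y] (ρ : QuasiIntegral X) (η : QuasiIntegral Y)
    (f : C_c(X × Y, ℝ)) : ℝ := ρ (S η f)

end product

end QuasiIntegral

/-! Call a set null if `openValue` vanishes on it.

Sufficiency. A quasi-integral is determined by its `openValue` on open sets
(`apply_eq_of_openValue_eq`): cut a nonnegative function into horizontal slices and compare each
slice with the open superlevel sets. So if `μ` is a measure, `ρ` is integration against it
(`apply_eq_integral`), and for two measures Fubini applies. If `μ` is `c` times the point mass at
`x₀`, then `ρ f = c * f x₀`, and both repeated quasi-integrals equal `c` times `η` of the fibre over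
`x₀`.

Necessity. If `η` charges two disjoint open sets, choose `g₁`, `g₂` supported in them with positive
values. Since `η` is linear on their span, comparing both orders on `k₁ ⊗ g₁ + k₂ ⊗ g₂` makes `ρ`
additive (`add_of_iterXY_eq_iterYX`), hence given by a measure by Riesz. The roles of `ρ` and `η`
can be exchanged. What remains is the case where one of them is simple: of any two disjoint open
sets one is null. A simple quasi-integral that is not a point mass has two null open sets with
non-null union (`exists_null_cover`), so it is not additive; this excludes exactly one being simple.
If both are simple and neither is a point mass, `iterXY_ne_iterYX` separates the two orders by `f₁ ⊗
g₁ + f₂ ⊗ g₂`, where `g₁`, `g₂` are null for `η` with non-null supremum, and `f₁`, `f₂` are non-null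
for `ρ` with supports meeting in a null set. -/

namespace QuasiIntegral

/-! ### Quasi-integrals are determined by their values on open sets -/

section determination

variable {X : Type*} [TopologicalSpace X] [T2Space X] [LocallyCompactSpace X]

/-- Any function admissible for `σ.openValue U` lies below `v`, so `ρ u ≤ ρ.openValue U ≤
σ.openValue U ≤ σ v`. -/
theorem le_of_openValue_le_of_one_le {ρ σ : QuasiIntegral X} {U : Set X}
    (h : ρ.openValue U ≤ σ.openValue U) {u v : C_c(X, ℝ)} (hu : ∀ x, 0 ≤ u x ∧ u x ≤ 1)
    (huU : tsupport u ⊆ U) (hv : ∀ x, 0 ≤ v x) (hvU : ∀ x ∈ U, 1 ≤ v x) : ρ u ≤ σ v := by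
  have h1 : σ.openValue U ≤ ENNReal.ofReal (σ v) := by
    refine iSup₂_le fun g hg => ENNReal.ofReal_le_ofReal (σ.mono (fun x => (hg.1 x).1) fun x => ?_)
    by_cases hx : g x = 0
    · rw [hx]; exact hv x
    · exact (hg.1 x).2.trans (hvU x (hg.2 (subset_tsupport _ hx)))
  exact (ENNReal.ofReal_le_ofReal_iff (σ.nonneg hv)).mp
    (((ρ.le_openValue hu huU).trans h).trans h1)

/-- Sum over slices of unit height. The slice of `f` between heights `n + 2` and `n + 3` has closed
support in `{n + 2 ≤ f}`, inside the open set `{n + 1 < f}`, on which the slice between `n` and `n +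
1` is constantly `1`. Leaving room between the closed and the open set is what makes the shift two
rather than one. -/
theorem clip_sub_clip_le {ρ σ : QuasiIntegral X}
    (h : ∀ U, IsOpen U → ρ.openValue U ≤ σ.openValue U) {f : C_c(X, ℝ)} (hf : ∀ x, 0 ≤ f x)
    (n : ℕ) : ρ (clip f (n + 2)) - ρ (clip f 2) ≤ σ (clip f n) := by
  induction n with
  | zero =>
    have e : clip f ((0 : ℕ) : ℝ) = 0 := by
      ext x; rw [clip_apply _ (by simp)]; simp [hf x]
    rw [e, σ.map_zero]; simp
  | succ n ih =>
    have p0 : (0 : ℝ) ≤ n := by positivity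
    have p1 : (0 : ℝ) ≤ n + 1 := by positivity
    have p2 : (0 : ℝ) ≤ n + 2 := by positivity
    have p3 : (0 : ℝ) ≤ n + 1 + 2 := by positivity
    have e1 := ρ.map_sub (clip_mem f p3) (clip_mem f p2)
    have e2 := σ.map_sub (clip_mem f p1) (clip_mem f p0)
    have e3 : ρ (clip f (n + 1 + 2) - clip f (n + 2)) ≤ σ (clip f (n + 1) - clip f n) := by
      have hU : IsOpen {x | (n : ℝ) + 1 < f x} := isOpen_lt continuous_const f.continuous
      refine le_of_openValue_le_of_one_le (h _ hU) (fun x => ?_) ?_ (fun x => ?_) fun x hx => ?_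
      · rw [CompactlySupportedContinuousMap.sub_apply, clip_apply _ p3, clip_apply _ p2]
        rcases le_total (f x) (n + 2) with h | h
        · rw [min_eq_left h, min_eq_left (by linarith)]; simp
        · rw [min_eq_right h]
          refine ⟨sub_nonneg.mpr (le_min h (by linarith)), ?_⟩
          linarith [min_le_right (f x) ((n : ℝ) + 1 + 2)]
      · have hc : IsClosed {x | (n : ℝ) + 2 ≤ f x} := isClosed_le continuous_const f.continuous
        refine (closure_minimal (fun x hx => ?_) hc).trans fun x (hx : (n : ℝ) + 2 ≤ f x) =>
          (show (n : ℝ) + 1 < f x by linarith)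
        by_contra! hlt
        simp only [Set.mem_ofPred_eq, not_le] at hlt
        refine hx ?_
        rw [CompactlySupportedContinuousMap.sub_apply, clip_apply _ p3, clip_apply _ p2,
          min_eq_left hlt.le, min_eq_left (by linarith), sub_self]
      · rw [CompactlySupportedContinuousMap.sub_apply, clip_apply _ p1, clip_apply _ p0,
          sub_nonneg]
        exact min_le_min_left _ (by linarith)
      · replace hx : (n : ℝ) + 1 < f x := hx
        rw [CompactlySupportedContinuousMap.sub_apply, clip_apply _ p1, clip_apply _ p0,
          min_eq_right hx.le, min_eq_right (by linarith)]
        linarith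
    push_cast
    linarith

/-- A quasi-integral is monotone in its topological measure. -/
theorem le_of_openValue_le {ρ σ : QuasiIntegral X}
    (h : ∀ U, IsOpen U → ρ.openValue U ≤ σ.openValue U) {f : C_c(X, ℝ)} (hf : ∀ x, 0 ≤ f x) :
    ρ f ≤ σ f := by
  obtain ⟨w, hw, -, V, -, hV, hV1⟩ :=
    exists_urysohn f.hasCompactSupport isOpen_univ (Set.subset_univ _)
  have hw1 : ∀ x, f x ≠ 0 → w x = 1 := fun x hx => hV1 x (hV (subset_tsupport _ hx))
  -- The shift by two costs at most `2 * ρ w`, whatever the size of the function. Applying the slice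
  -- estimate to `t • f` with `t` large makes this error negligible.
  have key : ∀ t : ℝ, 0 ≤ t → t * (ρ f - σ f) ≤ 2 * ρ w := by
    intro t ht
    have htf : ∀ x, 0 ≤ (t • f) x := fun x => by simpa using mul_nonneg ht (hf x)
    obtain ⟨C, hC⟩ := exists_bound (t • f)
    obtain ⟨n, hn⟩ := exists_nat_ge C
    have h1 := clip_sub_clip_le h htf n
    have e1 : clip (t • f) (n + 2) = t • f := by
      ext x
      rw [clip_apply _ (by positivity), min_eq_left]
      linarith [hC x]
    have e2 : clip (t • f) n = t • f := by
      ext x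
      rw [clip_apply _ (by positivity), min_eq_left]
      linarith [hC x]
    have h2 : ρ (clip (t • f) 2) ≤ 2 * ρ w := by
      refine ρ.map_le_of_eq_one zero_le_two (fun x => ?_) (fun x => ?_) (fun x => (hw x).1)
        (fun x => (hw x).2) fun x hx => hw1 x fun h0 => hx ?_
      · rw [clip_apply _ zero_le_two]; exact le_min (htf x) zero_le_two
      · rw [clip_apply _ zero_le_two]; exact min_le_right _ _
      · rw [clip_apply _ zero_le_two, CompactlySupportedContinuousMap.smul_apply, h0, smul_zero,
          min_eq_left zero_le_two]
    rw [e1, e2, ρ.map_smul, σ.map_smul] at h1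
    linarith
  by_contra! hlt
  have hd : 0 < ρ f - σ f := sub_pos.mpr hlt
  have hwn : 0 ≤ ρ w := ρ.nonneg fun x => (hw x).1
  have := key ((2 * ρ w + 1) / (ρ f - σ f)) (by positivity)
  rw [div_mul_cancel₀ _ hd.ne'] at this
  linarith

theorem apply_eq_of_openValue_eq {ρ σ : QuasiIntegral X}
    (h : ∀ U, IsOpen U → ρ.openValue U = σ.openValue U) (f : C_c(X, ℝ)) : ρ f = σ f := by
  have pos : ∀ g : C_c(X, ℝ), ρ (g ⊔ 0) = σ (g ⊔ 0) := fun g =>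
    le_antisymm (le_of_openValue_le (fun U hU => (h U hU).le) fun x => by simp)
      (le_of_openValue_le (fun U hU => (h U hU).ge) fun x => by simp)
  rw [ρ.map_eq_pos_sub_neg f, σ.map_eq_pos_sub_neg f, pos, pos]

end determination

/-! ### Integration against Borel measures -/

section measure

open MeasureTheory

variable {X : Type*} [TopologicalSpace X] [MeasurableSpace X] [BorelSpace X]

/-- Integration against a Borel measure that is finite on compact sets. -/
noncomputable def ofMeasure (m : Measure X) [IsFiniteMeasureOnCompacts m] : QuasiIntegral X where
  toFun f := ∫ x, f x ∂m
  map_smul' a f := by simpa using integral_const_mul a (fun x => f x)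
  map_add' _ g _ h _ := integral_add
    (g.continuous.integrable_of_hasCompactSupport g.hasCompactSupport)
    (h.continuous.integrable_of_hasCompactSupport h.hasCompactSupport)
  nonneg' _ hf := integral_nonneg hf

theorem ofMeasure_apply (m : Measure X) [IsFiniteMeasureOnCompacts m] (f : C_c(X, ℝ)) :
    ofMeasure m f = ∫ x, f x ∂m := rfl

theorem ofReal_ofMeasure (m : Measure X) [IsFiniteMeasureOnCompacts m] {f : C_c(X, ℝ)}
    (hf : ∀ x, 0 ≤ f x) : ENNReal.ofReal (ofMeasure m f) = ∫⁻ x, ENNReal.ofReal (f x) ∂m :=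
  ofReal_integral_eq_lintegral_ofReal
    (f.continuous.integrable_of_hasCompactSupport f.hasCompactSupport) (.of_forall hf)

variable [T2Space X] [LocallyCompactSpace X]

/-- Functions supported in `U` lie below its indicator, and Urysohn functions lie above the
indicators of compact subsets. Inner regularity is asked only at `U`, so it can come either from a
topological measure or from a Riesz measure. -/
theorem openValue_ofMeasure (m : Measure X) [IsFiniteMeasureOnCompacts m] {U : Set X}
    (hU : IsOpen U) (hm : m U ≤ ⨆ (K : Set X) (_ : IsCompact K ∧ K ⊆ U), m K) :
    (ofMeasure m).openValue U = m U := by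
  apply le_antisymm
  · refine iSup₂_le fun f hf => ?_
    rw [ofReal_ofMeasure m fun x => (hf.1 x).1, ← lintegral_indicator_one hU.measurableSet]
    refine lintegral_mono fun x => ?_
    by_cases hx : x ∈ U
    · simpa [hx] using (hf.1 x).2
    · have : f x = 0 := by
        by_contra h
        exact hx (hf.2 (subset_tsupport _ h))
      simp [this]
  · refine hm.trans (iSup₂_le fun K hK => ?_)
    obtain ⟨w, hw, hwU, V, -, hKV, hV⟩ := exists_urysohn hK.1 hU hK.2
    refine le_trans ?_ (le_openValue _ hw hwU)
    rw [ofReal_ofMeasure m fun x => (hw x).1, ← lintegral_indicator_one hK.1.measurableSet]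
    refine lintegral_mono fun x => ?_
    by_cases hx : x ∈ K
    · simp [hx, hV x (hKV hx)]
    · simp [hx]

/-- If the topological measure of `ρ` is the restriction of a measure, then `ρ` is integration
against that measure. -/
theorem apply_eq_integral (ρ : QuasiIntegral X) {m : Measure X}
    (hm : ∀ A : Set X, IsOpen A ∨ IsClosed A → m A = ρ.topologicalMeasure A)
    (f : C_c(X, ℝ)) : ρ f = ∫ x, f x ∂m := by
  have : IsFiniteMeasureOnCompacts m := ⟨fun K hK => by
    rw [hm K (Or.inr hK.isClosed)]; exact ρ.setValue_lt_top hK⟩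
  rw [← ofMeasure_apply]
  refine apply_eq_of_openValue_eq (fun U hU => ?_) f
  rw [openValue_ofMeasure m hU, hm U (Or.inl hU), ← ρ.setValue_of_isOpen hU]
  · rfl
  · rw [hm U (Or.inl hU), ρ.topologicalMeasure.inner' U hU]
    refine iSup₂_mono fun K hK => ?_
    rw [hm K (Or.inr hK.1.isClosed)]

end measure

/-! ### Point masses, and additive quasi-integrals via Riesz representation -/

section measure

variable {X : Type*} [TopologicalSpace X] [T2Space X] [LocallyCompactSpace X]

theorem apply_eq_of_isPosMulPointMass {ρ : QuasiIntegral X}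
    (h : ρ.topologicalMeasure.IsPosMulPointMass) : ∃ (c : ℝ) (x₀ : X), ∀ f, ρ f = c * f x₀ := by
  obtain ⟨c, -, x₀, h⟩ := h
  borelize X
  refine ⟨c, x₀, fun f => ?_⟩
  rw [ρ.apply_eq_integral (m := c • MeasureTheory.Measure.dirac x₀)]
  · rw [MeasureTheory.integral_smul_nnreal_measure, MeasureTheory.integral_dirac]
    rfl
  · intro A hA
    have hA' : MeasurableSet A := hA.elim IsOpen.measurableSet IsClosed.measurableSet
    rw [h A hA, MeasureTheory.Measure.smul_apply, MeasureTheory.Measure.dirac_apply' _ hA']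
    by_cases hx : x₀ ∈ A <;> simp [hx]

/-- The topological measure of a linear quasi-integral is a measure. -/
theorem isMeasure_of_add {ρ : QuasiIntegral X} (h : ∀ f g, ρ (f + g) = ρ f + ρ g) :
    ρ.topologicalMeasure.IsMeasure := by
  borelize X
  let Λ : C_c(X, ℝ) →ₚ[ℝ] ℝ := PositiveLinearMap.mk₀
    { toFun := ρ, map_add' := h, map_smul' := ρ.map_smul } fun f hf => ρ.nonneg fun x => hf x
  let m := RealRMK.rieszMeasure Λ
  have hρ : ρ.toFun = (ofMeasure m).toFun := by
    funext f
    exact (RealRMK.integral_rieszMeasure Λ f).symm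
  have hopen : ∀ U, IsOpen U → ρ.openValue U = m U := fun U hU => by
    have e : ρ.openValue U = (ofMeasure m).openValue U := by
      unfold openValue; rw [hρ]
    rw [e, openValue_ofMeasure m hU]
    rw [hU.measure_eq_iSup_isCompact m]
    exact iSup_mono fun K => iSup_le fun h1 => iSup_le fun h2 => le_iSup_of_le ⟨h2, h1⟩ le_rfl
  refine ⟨m, fun A _ => ?_⟩
  change m A = ρ.setValue A
  -- Both `m` and `setValue` are infima over open supersets, so agreement on open sets is enough.
  rw [A.measure_eq_iInf_isOpen m]
  apply le_antisymm
  · refine le_iInf₂ fun U hU => ?_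
    rw [hopen U hU.1]
    exact iInf_le_of_le U (iInf_le_of_le hU.2 (iInf_le_of_le hU.1 le_rfl))
  · refine le_iInf fun U => le_iInf fun h1 => le_iInf fun h2 => ?_
    rw [← hopen U h2]
    exact ρ.setValue_le h2 h1

end measure

/-! ### Null and non-null sets -/

section support

variable {X : Type*} [TopologicalSpace X]

theorem apply_nonpos_of_openValue_eq_zero {ρ : QuasiIntegral X} {U : Set X}
    (hU : ρ.openValue U = 0) {f : C_c(X, ℝ)} (hf : ∀ x, 0 ≤ f x ∧ f x ≤ 1)
    (hfU : tsupport f ⊆ U) : ρ f ≤ 0 :=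
  ENNReal.ofReal_eq_zero.mp (le_antisymm (hU ▸ ρ.le_openValue hf hfU) zero_le)

theorem exists_pos_of_openValue_ne_zero {ρ : QuasiIntegral X} {U : Set X}
    (hU : ρ.openValue U ≠ 0) :
    ∃ f : C_c(X, ℝ), (∀ x, 0 ≤ f x ∧ f x ≤ 1) ∧ tsupport f ⊆ U ∧ 0 < ρ f := by
  simp only [openValue, ne_eq, ENNReal.iSup_eq_zero, not_forall, ENNReal.ofReal_eq_zero,
    not_le] at hU
  obtain ⟨f, hf, hpos⟩ := hU
  exact ⟨f, hf.1, hf.2, hpos⟩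

variable {ρ : QuasiIntegral X}

theorem openValue_univ_ne_zero (hρ : ∃ f : C_c(X, ℝ), ρ f ≠ 0) : ρ.openValue Set.univ ≠ 0 := by
  intro h
  obtain ⟨f, hf⟩ := hρ
  refine hf (?_ : ρ f = 0)
  have pos : ∀ g : C_c(X, ℝ), ρ (g ⊔ 0) = 0 := by
    intro g
    have hn : ∀ x, 0 ≤ (g ⊔ 0) x := fun x => by simp
    obtain ⟨C, hC⟩ := exists_bound (g ⊔ 0)
    -- The bound `C` need not be positive; `max C 1` can be divided by, which scales the function
    -- into `[0, 1]`.
    have hpos : 0 < max C 1 := lt_max_of_lt_right one_pos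
    have h1 := apply_nonpos_of_openValue_eq_zero h (f := (max C 1)⁻¹ • (g ⊔ 0))
      (fun x => ⟨mul_nonneg (inv_nonneg.mpr hpos.le) (hn x),
        inv_mul_le_one_of_le₀ ((hC x).trans (le_max_left _ _)) hpos.le⟩) (Set.subset_univ _)
    rw [ρ.map_smul] at h1
    exact le_antisymm (nonpos_of_mul_nonpos_right h1 (inv_pos.mpr hpos)) (ρ.nonneg hn)
  rw [ρ.map_eq_pos_sub_neg f, pos, pos, sub_zero]

end support

/-! ### Tensor products and interchange of the two orders -/

section product

variable {X Y : Type*} [TopologicalSpace X] [TopologicalSpace Y]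

/-- The function `f ⊗ g` on `X × Y`. -/
def tensor (f : C_c(X, ℝ)) (g : C_c(Y, ℝ)) : C_c(X × Y, ℝ) where
  toFun p := f p.1 * g p.2
  continuous_toFun := by fun_prop
  hasCompactSupport' := by
    refine HasCompactSupport.intro' (f.hasCompactSupport.isCompact.prod
      g.hasCompactSupport.isCompact) ((isClosed_tsupport f).prod (isClosed_tsupport g))
      fun p hp => ?_
    by_contra h
    exact hp ⟨subset_tsupport _ (left_ne_zero_of_mul h), subset_tsupport _ (right_ne_zero_of_mul h)⟩

theorem fiberX_tensor [T2Space X] (f : C_c(X, ℝ)) (g : C_c(Y, ℝ)) (y : Y) :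
    fiberX (tensor f g) y = g y • f := by
  ext x; exact mul_comm _ _

variable [T2Space X] [T2Space Y]

theorem T_tensor_add_apply [LocallyCompactSpace X] (ρ : QuasiIntegral X) (f₁ f₂ : C_c(X, ℝ))
    (g₁ g₂ : C_c(Y, ℝ)) (y : Y) :
    T ρ (tensor f₁ g₁ + tensor f₂ g₂) y = ρ (g₁ y • f₁ + g₂ y • f₂) := by
  rw [← fiberX_tensor, ← fiberX_tensor]; rfl

theorem S_tensor_add_apply [LocallyCompactSpace Y] (η : QuasiIntegral Y) (f₁ f₂ : C_c(X, ℝ))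
    (g₁ g₂ : C_c(Y, ℝ)) (x : X) :
    S η (tensor f₁ g₁ + tensor f₂ g₂) x = η (f₁ x • g₁ + f₂ x • g₂) := rfl

/-- Interchanging the factors of `X × Y`. -/
def swap (f : C_c(X × Y, ℝ)) : C_c(Y × X, ℝ) where
  toFun p := f p.swap
  continuous_toFun := by fun_prop
  hasCompactSupport' := f.hasCompactSupport.comp_homeomorph (Homeomorph.prodComm Y X)

variable [LocallyCompactSpace X] [LocallyCompactSpace Y] {ρ : QuasiIntegral X}
  {η : QuasiIntegral Y}

/-- Interchanging the coordinates turns each order into the other by unfolding, so results about `ρ`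
transfer to `η`. -/
theorem iterXY_eq_iterYX_symm (h : iterXY η ρ = iterYX ρ η) : iterXY ρ η = iterYX η ρ :=
  funext fun f => (congrFun h (swap f)).symm

theorem iterXY_eq_iterYX_of_isMeasure (hρ : ρ.topologicalMeasure.IsMeasure)
    (hη : η.topologicalMeasure.IsMeasure) : iterXY η ρ = iterYX ρ η := by
  borelize X
  borelize Y
  obtain ⟨m, hm⟩ := hρ
  obtain ⟨n, hn⟩ := hη
  have : MeasureTheory.IsFiniteMeasureOnCompacts m := ⟨fun K hK => by
    rw [hm K (Or.inr hK.isClosed)]; exact ρ.setValue_lt_top hK⟩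
  have : MeasureTheory.IsFiniteMeasureOnCompacts n := ⟨fun K hK => by
    rw [hn K (Or.inr hK.isClosed)]; exact η.setValue_lt_top hK⟩
  funext f
  calc iterXY η ρ f = ∫ y, ∫ x, f (x, y) ∂m ∂n := by
        rw [iterXY, η.apply_eq_integral hn]
        exact MeasureTheory.integral_congr_ae (.of_forall fun y => ρ.apply_eq_integral hm (fiberX f y))
    _ = ∫ x, ∫ y, f (x, y) ∂n ∂m :=
        -- `m` and `n` need not be σ-finite; continuity and compact support of `f` replace this in
        -- Fubini.
        (MeasureTheory.integral_integral_swap_of_hasCompactSupport (f := fun x y => f (x, y))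
          f.continuous f.hasCompactSupport).symm
    _ = iterYX ρ η f := by
        rw [iterYX, ρ.apply_eq_integral hm]
        exact MeasureTheory.integral_congr_ae
          (.of_forall fun x => (η.apply_eq_integral hn (fiberY f x)).symm)

theorem iterXY_eq_iterYX_of_isPosMulPointMass (hρ : ρ.topologicalMeasure.IsPosMulPointMass) :
    iterXY η ρ = iterYX ρ η := by
  obtain ⟨c, x₀, h⟩ := apply_eq_of_isPosMulPointMass hρ
  funext f
  have e : T ρ f = c • fiberY f x₀ := by
    ext y; exact h _
  rw [iterXY, iterYX, h, e, η.map_smul]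
  rfl

/-- If the repeated quasi-integrals agree and `η` charges two disjoint open sets, then `ρ` is
additive. -/
theorem add_of_iterXY_eq_iterYX (h : iterXY η ρ = iterYX ρ η) {U V : Set Y} (hd : Disjoint U V)
    (hU : η.openValue U ≠ 0) (hV : η.openValue V ≠ 0) (f₁ f₂ : C_c(X, ℝ)) :
    ρ (f₁ + f₂) = ρ f₁ + ρ f₂ := by
  obtain ⟨g₁, hg₁', hs₁, hp₁⟩ := exists_pos_of_openValue_ne_zero hU
  obtain ⟨g₂, hg₂', hs₂, hp₂⟩ := exists_pos_of_openValue_ne_zero hV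
  have hg₁ : ∀ y, 0 ≤ g₁ y := fun y => (hg₁' y).1
  have hg₂ : ∀ y, 0 ≤ g₂ y := fun y => (hg₂' y).1
  have h0 : ∀ y, g₁ y = 0 ∨ g₂ y = 0 := by
    intro y
    by_contra! hy
    exact Set.disjoint_left.mp hd (hs₁ (subset_tsupport _ hy.1)) (hs₂ (subset_tsupport _ hy.2))
  -- Since `g₁` and `g₂` are nonnegative and never both nonzero, they are the positive and negative
  -- parts of `g₁ - g₂`; thus all their multiples lie in the subalgebra it generates.
  have hη : ∀ a b : ℝ, η (a • g₁ + b • g₂) = a * η g₁ + b * η g₂ := by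
    intro a b
    rw [η.map_add (f := g₁ - g₂) (g := a • g₁) (h := b • g₂), η.map_smul, η.map_smul]
    · refine ⟨⟨fun t => a * max t 0, by fun_prop⟩, by simp, fun y => ?_⟩
      rcases h0 y with hy | hy <;> simp [hy, hg₁ y, hg₂ y]
    · refine ⟨⟨fun t => b * max (-t) 0, by fun_prop⟩, by simp, fun y => ?_⟩
      rcases h0 y with hy | hy <;> simp [hy, hg₁ y, hg₂ y]
  -- This normalization makes the `S` side exactly `f₁ + f₂`. The `T` side needs only homogeneity of
  -- `ρ`, as at each `y` at most one term survives.
  let k₁ : C_c(X, ℝ) := (η g₁)⁻¹ • f₁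
  let k₂ : C_c(X, ℝ) := (η g₂)⁻¹ • f₂
  have hT : T ρ (tensor k₁ g₁ + tensor k₂ g₂) = ρ k₁ • g₁ + ρ k₂ • g₂ := by
    ext y
    rw [T_tensor_add_apply]
    rcases h0 y with hy | hy <;> simp [hy, ρ.map_smul, mul_comm]
  have hS : S η (tensor k₁ g₁ + tensor k₂ g₂) = f₁ + f₂ := by
    ext x
    rw [S_tensor_add_apply, hη]
    simp only [k₁, k₂, CompactlySupportedContinuousMap.smul_apply,
      CompactlySupportedContinuousMap.add_apply, smul_eq_mul]
    field_simp
  have key := congrFun h (tensor k₁ g₁ + tensor k₂ g₂)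
  rw [iterXY, iterYX, hT, hS, hη, ρ.map_smul, ρ.map_smul] at key
  rw [← key]
  field_simp

end product

/-! ### Simple quasi-integrals -/

section simple

variable {X : Type*} [TopologicalSpace X]

/-- Of any two disjoint open sets one is null. -/
def IsSimple (ρ : QuasiIntegral X) : Prop :=
  ∀ U V : Set X, IsOpen U → IsOpen V → Disjoint U V → ρ.openValue U = 0 ∨ ρ.openValue V = 0

variable [T2Space X] {ρ : QuasiIntegral X}

theorem openValue_univ_eq_add_compl [LocallyCompactSpace X] {K : Set X} (hK : IsCompact K) :
    ρ.openValue Set.univ = ρ.setValue K + ρ.openValue Kᶜ := by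
  rw [← Set.union_compl_self K]
  exact ρ.openValue_compact_union hK disjoint_compl_right (by simp)

namespace IsSimple

/-- A function supported in `Kᶜ` has compact support, which disjoint open sets separate from `K`.
The one around `K` is not null, so the other is. -/
theorem openValue_compl_eq_zero (hs : ρ.IsSimple) {K : Set X} (hK : IsCompact K)
    (h : ρ.setValue K ≠ 0) : ρ.openValue Kᶜ = 0 := by
  by_contra hc
  obtain ⟨f, hf, hfK, hpos⟩ := exists_pos_of_openValue_ne_zero hc
  obtain ⟨U, V, hU, hV, hKU, hfV, hUV⟩ := SeparatedNhds.of_isCompact_isCompact hK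
    f.hasCompactSupport.isCompact (Set.disjoint_left.mpr fun x hx hxf => hfK hxf hx)
  rcases hs U V hU hV hUV with h0 | h0
  · exact h (le_antisymm (h0 ▸ ρ.setValue_le hU hKU) zero_le)
  · exact hpos.not_ge (apply_nonpos_of_openValue_eq_zero h0 hf hfV)

variable [LocallyCompactSpace X]

/-- The complement of `{x₀}` is null, so `{x₀}` carries the whole mass. -/
theorem isPosMulPointMass (hs : ρ.IsSimple) {x₀ : X} (h : ρ.setValue {x₀} ≠ 0) :
    ρ.topologicalMeasure.IsPosMulPointMass := by
  have hfin : ρ.setValue {x₀} ≠ ∞ := (ρ.setValue_lt_top isCompact_singleton).ne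
  have h0 := hs.openValue_compl_eq_zero isCompact_singleton h
  refine ⟨(ρ.setValue {x₀}).toNNReal, ENNReal.toNNReal_pos h hfin, x₀, fun A _ => ?_⟩
  rw [ENNReal.coe_toNNReal hfin]
  change ρ.setValue A = _
  by_cases hx : x₀ ∈ A
  · rw [Set.indicator_of_mem hx]
    refine le_antisymm ?_ (ρ.setValue_mono (Set.singleton_subset_iff.mpr hx))
    calc ρ.setValue A ≤ ρ.openValue Set.univ := ρ.setValue_le isOpen_univ (Set.subset_univ _)
      _ = ρ.setValue {x₀} := by
        rw [openValue_univ_eq_add_compl isCompact_singleton, h0, add_zero]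
  · rw [Set.indicator_of_notMem hx]
    refine le_antisymm (h0 ▸ ρ.setValue_le isOpen_compl_singleton fun x hxA => ?_) zero_le
    rintro rfl
    exact hx hxA

/-- A simple quasi-integral that is not a multiple of a point mass has two null open sets
whose union is not null. -/
theorem exists_null_cover (hs : ρ.IsSimple) (hρ : ∃ f : C_c(X, ℝ), ρ f ≠ 0)
    (hp : ¬ρ.topologicalMeasure.IsPosMulPointMass) :
    ∃ U V : Set X, IsOpen U ∧ IsOpen V ∧ ρ.openValue U = 0 ∧ ρ.openValue V = 0 ∧
      ρ.openValue (U ∪ V) ≠ 0 := by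
  by_contra! hcon
  have hne := openValue_univ_ne_zero hρ
  obtain ⟨f, hf, -, hpos⟩ := exists_pos_of_openValue_ne_zero hne
  -- A non-null open set contains a non-null compact set, whose complement is null; hence it has
  -- full mass.
  have hlarge : ∀ U : Set X, IsOpen U → ρ.openValue U ≠ 0 →
      ρ.openValue Set.univ ≤ ρ.openValue U := by
    intro U hUo hU
    obtain ⟨g, hg, hgU, hgp⟩ := exists_pos_of_openValue_ne_zero hU
    have hK : ENNReal.ofReal (ρ g) ≤ ρ.setValue (tsupport g) :=
      le_iInf₂ fun V hV => ρ.le_openValue hg hV.2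
    have hgK := g.hasCompactSupport.isCompact
    rw [openValue_univ_eq_add_compl hgK, hs.openValue_compl_eq_zero hgK
      ((ENNReal.ofReal_pos.mpr hgp).trans_le hK).ne', add_zero]
    exact ρ.setValue_le hUo hgU
  -- Points are null, as `ρ` is not a point mass. Open sets being null or of full mass, the infimum
  -- over neighbourhoods of a point can vanish only if one of them is null.
  have hloc : ∀ x, ∃ U : Set X, IsOpen U ∧ x ∈ U ∧ ρ.openValue U = 0 := by
    intro x
    have hx : ρ.setValue {x} = 0 := by
      by_contra h
      exact hp (hs.isPosMulPointMass h)
    by_contra! hU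
    refine hne (le_antisymm (hx ▸ le_iInf₂ fun U hU' => ?_) zero_le)
    exact hlarge U hU'.1 (hU U hU'.1 (hU'.2 rfl))
  -- By `hcon` null open sets are closed under finite unions, so compactness puts the support of `f`
  -- in a null open set, against `0 < ρ f`.
  obtain ⟨U, hU, hfU, hU0⟩ := f.hasCompactSupport.isCompact.induction_on
    (p := fun s => ∃ U : Set X, IsOpen U ∧ s ⊆ U ∧ ρ.openValue U = 0)
    ⟨∅, isOpen_empty, subset_rfl, le_antisymm (iSup₂_le fun g hg => by
      have : g = 0 := by
        ext x; by_contra hx; exact hg.2 (subset_tsupport _ hx)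
      simp [this, ρ.map_zero]) zero_le⟩
    (fun s t hst ⟨U, hU, htU, h0⟩ => ⟨U, hU, hst.trans htU, h0⟩)
    (fun s t ⟨U, hU, hsU, hU0⟩ ⟨V, hV, htV, hV0⟩ =>
      ⟨U ∪ V, hU.union hV, Set.union_subset_union hsU htV, hcon U V hU hV hU0 hV0⟩)
    fun x _ => by
      obtain ⟨U, hU, hxU, h0⟩ := hloc x
      exact ⟨U, mem_nhdsWithin_of_mem_nhds (hU.mem_nhds hxU), U, hU, subset_rfl, h0⟩
  exact hpos.not_ge (apply_nonpos_of_openValue_eq_zero hU0 hf hfU)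

/-- Two null compact sets whose union has null complement, while neither complement is null,
with two null functions whose supremum is not null. -/
theorem exists_functions (hs : ρ.IsSimple) (hρ : ∃ f : C_c(X, ℝ), ρ f ≠ 0)
    (hp : ¬ρ.topologicalMeasure.IsPosMulPointMass) :
    ∃ g₁ g₂ f₁ f₂ : C_c(X, ℝ), (∀ x, 0 ≤ g₁ x) ∧ (∀ x, 0 ≤ g₂ x) ∧ (∀ x, 0 ≤ f₁ x) ∧
      (∀ x, 0 ≤ f₂ x) ∧ ρ g₁ = 0 ∧ ρ g₂ = 0 ∧ 0 < ρ (g₁ ⊔ g₂) ∧ 0 < ρ f₁ ∧ 0 < ρ f₂ ∧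
      ρ.openValue (tsupport f₁ ∩ tsupport f₂) = 0 := by
  obtain ⟨U, V, hU, hV, hU0, hV0, hUV⟩ := hs.exists_null_cover hρ hp
  obtain ⟨f, hf, hfUV, hpos⟩ := exists_pos_of_openValue_ne_zero hUV
  have hK := f.hasCompactSupport.isCompact
  obtain ⟨C, D, hC, hD, hCU, hDV, hCD⟩ := hK.binary_compact_cover hU hV hfUV
  have hKpos : ρ.setValue (tsupport f) ≠ 0 :=
    ((ENNReal.ofReal_pos.mpr hpos).trans_le
      (le_iInf₂ fun W hW => ρ.le_openValue hf hW.2)).ne'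
  -- A compact subset `E` of a null open set is null, so its complement carries all the mass and
  -- supports a non-null `k`.
  have null : ∀ {W E : Set X}, IsOpen W → ρ.openValue W = 0 → IsCompact E → E ⊆ W →
      ∃ g k : C_c(X, ℝ), (∀ x, 0 ≤ g x) ∧ ρ g = 0 ∧ (∀ x ∈ E, g x = 1) ∧
        (∀ x, 0 ≤ k x) ∧ 0 < ρ k ∧ tsupport k ⊆ Eᶜ := by
    intro W E hW hW0 hE hEW
    obtain ⟨g, hg, hgW, N, -, hEN, hN⟩ := exists_urysohn hE hW hEW
    have hE0 : ρ.setValue E = 0 := le_antisymm (hW0 ▸ ρ.setValue_le hW hEW) zero_le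
    have hEc : ρ.openValue Eᶜ ≠ 0 := by
      have := openValue_univ_ne_zero hρ
      rwa [openValue_univ_eq_add_compl hE, hE0, zero_add] at this
    obtain ⟨k, hk, hkE, hkp⟩ := exists_pos_of_openValue_ne_zero hEc
    exact ⟨g, k, fun x => (hg x).1, le_antisymm (apply_nonpos_of_openValue_eq_zero hW0 hg hgW)
      (ρ.nonneg fun x => (hg x).1), fun x hx => hN x (hEN hx), fun x => (hk x).1, hkp, hkE⟩
  obtain ⟨g₁, f₁, hg₁, hg₁0, hg₁C, hf₁, hf₁p, hf₁C⟩ := null hU hU0 hC hCU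
  obtain ⟨g₂, f₂, hg₂, hg₂0, hg₂D, hf₂, hf₂p, hf₂D⟩ := null hV hV0 hD hDV
  refine ⟨g₁, g₂, f₁, f₂, hg₁, hg₂, hf₁, hf₂, hg₁0, hg₂0, hpos.trans_le ?_, hf₁p, hf₂p, ?_⟩
  · refine ρ.mono (fun x => (hf x).1) fun x => ?_
    rw [CompactlySupportedContinuousMap.sup_apply]
    by_cases hx : f x = 0
    · rw [hx]; exact le_max_of_le_left (hg₁ x)
    · rcases hCD ▸ subset_tsupport _ hx with h | h
      · exact le_max_of_le_left (by rw [hg₁C x h]; exact (hf x).2)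
      · exact le_max_of_le_right (by rw [hg₂D x h]; exact (hf x).2)
  -- The supports avoid `C` and `D` respectively, so they meet only outside `C ∪ D = tsupport f`,
  -- which is non-null and therefore has null complement.
  · refine le_antisymm ?_ zero_le
    rw [← hs.openValue_compl_eq_zero hK hKpos, hCD, Set.compl_union]
    exact ρ.openValue_mono (Set.inter_subset_inter hf₁C hf₂D)

/-- The supremum of two nonnegative null functions lies below their sum, so additivity would make it
null too. -/
theorem not_forall_add (hs : ρ.IsSimple) (hρ : ∃ f : C_c(X, ℝ), ρ f ≠ 0)
    (hp : ¬ρ.topologicalMeasure.IsPosMulPointMass) : ¬∀ f g, ρ (f + g) = ρ f + ρ g := by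
  intro h
  obtain ⟨g₁, g₂, -, -, hg₁, hg₂, -, -, h₁, h₂, hpos, -⟩ := hs.exists_functions hρ hp
  have : ρ (g₁ ⊔ g₂) ≤ ρ (g₁ + g₂) := by
    refine ρ.mono (fun x => le_max_of_le_left (hg₁ x)) fun x => max_le ?_ ?_
    · exact le_add_of_nonneg_right (hg₂ x)
    · exact le_add_of_nonneg_left (hg₁ x)
  rw [h, h₁, h₂, add_zero] at this
  exact hpos.not_ge this

/-- The test function pairs non-null `f₁`, `f₂` with null `g₁`, `g₂`. Integrating over `X` first
leaves at least a positive multiple of the non-null `g₁ ⊔ g₂`; integrating over `Y` first leaves a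
function supported in the null set `tsupport f₁ ∩ tsupport f₂`. -/
theorem iterXY_ne_iterYX {Y : Type*} [TopologicalSpace Y] [T2Space Y] [LocallyCompactSpace Y]
    {η : QuasiIntegral Y} (hρs : ρ.IsSimple) (hρ : ∃ f : C_c(X, ℝ), ρ f ≠ 0)
    (hρp : ¬ρ.topologicalMeasure.IsPosMulPointMass) (hηs : η.IsSimple)
    (hη : ∃ g : C_c(Y, ℝ), η g ≠ 0) (hηp : ¬η.topologicalMeasure.IsPosMulPointMass) :
    iterXY η ρ ≠ iterYX ρ η := by
  intro h
  obtain ⟨-, -, f₁, f₂, -, -, hf₁, hf₂, -, -, -, hf₁p, hf₂p, hnull⟩ :=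
    hρs.exists_functions hρ hρp
  obtain ⟨g₁, g₂, -, -, hg₁, hg₂, -, -, hg₁0, hg₂0, hgp, -⟩ := hηs.exists_functions hη hηp
  let F := tensor f₁ g₁ + tensor f₂ g₂
  have hT : ∀ y, (min (ρ f₁) (ρ f₂) • (g₁ ⊔ g₂)) y ≤ T ρ F y := by
    intro y
    rw [T_tensor_add_apply, CompactlySupportedContinuousMap.smul_apply,
      CompactlySupportedContinuousMap.sup_apply, smul_eq_mul,
      mul_max_of_nonneg _ _ (le_min hf₁p.le hf₂p.le)]
    have a₁ : ∀ x, 0 ≤ (g₁ y • f₁) x := fun x => mul_nonneg (hg₁ y) (hf₁ x)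
    have a₂ : ∀ x, 0 ≤ (g₂ y • f₂) x := fun x => mul_nonneg (hg₂ y) (hf₂ x)
    apply max_le
    · calc min (ρ f₁) (ρ f₂) * g₁ y ≤ ρ f₁ * g₁ y :=
            mul_le_mul_of_nonneg_right (min_le_left _ _) (hg₁ y)
        _ = ρ (g₁ y • f₁) := by rw [ρ.map_smul, mul_comm]
        _ ≤ _ := ρ.mono a₁ fun x => le_add_of_nonneg_right (a₂ x)
    · calc min (ρ f₁) (ρ f₂) * g₂ y ≤ ρ f₂ * g₂ y :=
            mul_le_mul_of_nonneg_right (min_le_right _ _) (hg₂ y)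
        _ = ρ (g₂ y • f₂) := by rw [ρ.map_smul, mul_comm]
        _ ≤ _ := ρ.mono a₂ fun x => le_add_of_nonneg_left (a₁ x)
  have hTpos : 0 < η (T ρ F) := by
    have hmin : 0 < min (ρ f₁) (ρ f₂) := lt_min hf₁p hf₂p
    refine lt_of_lt_of_le ?_ (η.mono (fun y => ?_) hT)
    · rw [η.map_smul]; exact mul_pos hmin hgp
    · exact mul_nonneg hmin.le (le_max_of_le_left (hg₁ y))
  have hS0 : ∀ x, 0 ≤ S η F x := fun x => by
    rw [S_tensor_add_apply]
    exact η.nonneg fun y => add_nonneg (mul_nonneg (hf₁ x) (hg₁ y)) (mul_nonneg (hf₂ x) (hg₂ y))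
  -- Where one `fᵢ` vanishes, a multiple of a single null `gⱼ` remains, and `η` kills it by
  -- homogeneity.
  have hSs : tsupport (S η F) ⊆ tsupport f₁ ∩ tsupport f₂ := by
    refine Set.subset_inter (closure_mono fun x hx hx0 => hx ?_)
      (closure_mono fun x hx hx0 => hx ?_)
    · rw [S_tensor_add_apply, hx0, zero_smul, zero_add, η.map_smul, hg₂0, mul_zero]
    · rw [S_tensor_add_apply, hx0, zero_smul, add_zero, η.map_smul, hg₁0, mul_zero]
  obtain ⟨C, hC⟩ := exists_bound (S η F)
  have hCpos : 0 < max C 1 := lt_max_of_lt_right one_pos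
  have h1 := apply_nonpos_of_openValue_eq_zero hnull (f := (max C 1)⁻¹ • S η F)
    (fun x => ⟨mul_nonneg (inv_nonneg.mpr hCpos.le) (hS0 x),
      inv_mul_le_one_of_le₀ ((hC x).trans (le_max_left _ _)) hCpos.le⟩)
    ((closure_mono (Function.support_const_smul_subset _ _)).trans hSs)
  rw [ρ.map_smul] at h1
  have h2 : ρ (S η F) ≤ 0 := nonpos_of_mul_nonpos_right h1 (inv_pos.mpr hCpos)
  have h3 : η (T ρ F) = ρ (S η F) := congrFun h F
  exact (h3 ▸ hTpos).not_ge h2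

end IsSimple

end simple

end QuasiIntegral

/-! ### The equivalence, by cases on simplicity -/

theorem mainTheorem1 {X Y : Type*} [TopologicalSpace X] [T2Space X] [LocallyCompactSpace X]
    [TopologicalSpace Y] [T2Space Y] [LocallyCompactSpace Y]
    (ρ : QuasiIntegral X) (η : QuasiIntegral Y)
    (hρ : ∃ f : C_c(X, ℝ), ρ f ≠ 0) (hη : ∃ g : C_c(Y, ℝ), η g ≠ 0) :
    QuasiIntegral.iterXY η ρ = QuasiIntegral.iterYX ρ η ↔
      (ρ.topologicalMeasure.IsMeasure ∧ η.topologicalMeasure.IsMeasure) ∨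
      (ρ.topologicalMeasure.IsPosMulPointMass ∨ η.topologicalMeasure.IsPosMulPointMass) := by
  constructor
  · intro h
    by_contra! hcon
    obtain ⟨hm, hρp, hηp⟩ := hcon
    have addρ : ¬η.IsSimple → ∀ f g, ρ (f + g) = ρ f + ρ g := by
      intro hs
      simp only [QuasiIntegral.IsSimple, not_forall, not_or] at hs
      obtain ⟨U, V, -, -, hd, hU, hV⟩ := hs
      exact QuasiIntegral.add_of_iterXY_eq_iterYX h hd hU hV
    have addη : ¬ρ.IsSimple → ∀ f g, η (f + g) = η f + η g := by
      intro hs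
      simp only [QuasiIntegral.IsSimple, not_forall, not_or] at hs
      obtain ⟨U, V, -, -, hd, hU, hV⟩ := hs
      exact QuasiIntegral.add_of_iterXY_eq_iterYX
        (QuasiIntegral.iterXY_eq_iterYX_symm h) hd hU hV
    by_cases hρs : ρ.IsSimple
    · by_cases hηs : η.IsSimple
      · exact hρs.iterXY_ne_iterYX hρ hρp hηs hη hηp h
      -- As `η` is not simple, `ρ` is additive, which is impossible for a simple quasi-integral that
      -- is not a point mass.
      · exact hρs.not_forall_add hρ hρp (addρ hηs)
    · by_cases hηs : η.IsSimple
      · exact hηs.not_forall_add hη hηp (addη hρs)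
      · exact hm (QuasiIntegral.isMeasure_of_add (addρ hηs))
          (QuasiIntegral.isMeasure_of_add (addη hρs))
  · rintro (⟨h₁, h₂⟩ | h | h)
    · exact QuasiIntegral.iterXY_eq_iterYX_of_isMeasure h₁ h₂
    · exact QuasiIntegral.iterXY_eq_iterYX_of_isPosMulPointMass h
    · exact QuasiIntegral.iterXY_eq_iterYX_symm
        (QuasiIntegral.iterXY_eq_iterYX_of_isPosMulPointMass h)
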